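/- Let $n \ge 2$ and $0 < \delta < \varepsilon/3$. Let $S^n \subset \mathbb{R}^{n+1}$ be the unit sphere with the metric $d$ measuring distance along the sphere (so $d(x,-x)=\pi$), and let $\mathrm{BG}(n,\varepsilon)$ be the graph on the vertex set $S^n$ in which two distinct points $x,y$ are adjacent if and only if $d(x,-y) < \varepsilon$. Let $V \subseteq S^n$ be a finite set with $-v \in V$ for every $v \in V$, such that for each $x \in S^n$ there is some $v \in V$ with $d(v,x) < \delta$, and let $G$ be the subgraph of $\mathrm{BG}(n,\varepsilon)$ induced by $V$ (such a $G$ is called a $\delta$-approximation to $\mathrm{BG}(n,\varepsilon)$). Then $G$ is simply connected in the following sense: $G$ is connected, and any two walks in $G$ with the same first vertex, the same last vertex and lengths of the same parity are homotopic. Here a walk of length $k \ge 0$ is a sequence of vertices $v_0 \cdots v_k$ in which $v_iv_{i+1}$ is an edge for all $0 \le i < k$, and two walks are homotopic if one can be transformed into the other by finitely many steps of the following kinds, applied to a walk $v_0\cdots v_k$: (Sub) for some $0 < i < k$, replace $v_i$ by a common neighbor $v_i'$ of $v_{i-1}$ and $v_{i+1}$; (Ins) for some $0 \le i \le k$, replace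 $v_i$ by $v_i w v_i$ for some neighbor $w$ of $v_i$; (Del) for some $0 < i < k$ with $v_{i-1} = v_{i+1}$, replace $v_{i-1}v_iv_{i+1}$ by $v_{i-1}$. -/

import Mathlib

namespace BorsukHomotopy

/-- One elementary step between two walks with the same endpoints. -/
inductive HomotopyStep {V : Type*} (G : SimpleGraph V) {u v : V} :
    G.Walk u v → G.Walk u v → Prop
  /-- Substitution: replace an interior vertex `b`, with neighbours `a` and `c` on the walk,
  by any common neighbour `b'` of `a` and `c`. -/
  | sub {a b b' c : V} (p : G.Walk u a) (hab : G.Adj a b) (hbc : G.Adj b c)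
      (hab' : G.Adj a b') (hbc' : G.Adj b' c) (q : G.Walk c v) :
      HomotopyStep G (p.append (.cons hab (.cons hbc q)))
        (p.append (.cons hab' (.cons hbc' q)))
  /-- Insertion: replace a vertex `a` of the walk (possibly an endpoint) by `a w a`, where `w` is
  a neighbour of `a`. -/
  | ins {a w : V} (p : G.Walk u a) (haw : G.Adj a w) (q : G.Walk a v) :
      HomotopyStep G (p.append q) (p.append (.cons haw (.cons haw.symm q)))
  /-- Deletion: replace `a w a` inside the walk by `a`. -/
  | del {a w : V} (p : G.Walk u a) (haw : G.Adj a w) (hwa : G.Adj w a) (q : G.Walk a v) :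
      HomotopyStep G (p.append (.cons haw (.cons hwa q))) (p.append q)

/-- Two walks are homotopic if a finite sequence of elementary steps leads from one to the
other. (Every step preserves the endpoints, so only walks with common endpoints are compared.) -/
def Homotopic {V : Type*} (G : SimpleGraph V) {u v : V} (p q : G.Walk u v) : Prop :=
  Relation.ReflTransGen (HomotopyStep G) p q

/-- A graph is simply connected if it is connected and any two walks with the same first vertex,
the same last vertex and lengths of the same parity are homotopic. -/
def IsSimplyConnected {V : Type*} (G : SimpleGraph V) : Prop :=
  G.Connected ∧
    ∀ (u v : V) (p q : G.Walk u v), p.length ≡ q.length [MOD 2] → Homotopic G p q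

/-- The unit sphere `S^n` in `ℝ^(n+1)`. -/
abbrev Sphere (n : ℕ) : Type :=
  Metric.sphere (0 : EuclideanSpace ℝ (Fin (n + 1))) 1

/-- The distance along the sphere: the angle between two unit vectors, a number in `[0, π]`. -/
noncomputable def sphereDist {n : ℕ} (x y : Sphere n) : ℝ :=
  InnerProductGeometry.angle (x : EuclideanSpace ℝ (Fin (n + 1))) y

theorem sphereDist_neg_comm {n : ℕ} (x y : Sphere n) :
    sphereDist x (-y) = sphereDist y (-x) := by
  simp only [sphereDist, Metric.sphere, coe_neg_sphere, InnerProductGeometry.angle_neg_right]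
  rw [InnerProductGeometry.angle_comm]

/-- The Borsuk graph on `S^n`: distinct points `x`, `y` are adjacent when `d(x, -y) < ε`.
(For `ε ≤ π` the inequality already forces `x ≠ y`.) -/
def borsukGraph (n : ℕ) (ε : ℝ) : SimpleGraph (Sphere n) where
  Adj x y := x ≠ y ∧ sphereDist x (-y) < ε
  symm := ⟨fun x y h => ⟨h.1.symm, by rw [sphereDist_neg_comm]; exact h.2⟩⟩
  loopless := ⟨fun _ h => h.1 rfl⟩

/-- `G` is a `δ`-approximation to the Borsuk graph: an induced subgraph on a finite, antipodally
closed set of vertices such that every point of the sphere is at distance less than `δ` from some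
vertex. -/
structure IsApproximation {n : ℕ} {ε : ℝ} (δ : ℝ) (G : (borsukGraph n ε).Subgraph) : Prop where
  finite : G.verts.Finite
  neg_mem : ∀ v ∈ G.verts, -v ∈ G.verts
  induced : G.IsInduced
  dense : ∀ x : Sphere n, ∃ v ∈ G.verts, sphereDist v x < δ

end BorsukHomotopy

/-! Fix a base vertex. If `d(a,b) < ε`, then `a, -a, b` is a walk, and appending it carries walk
classes ending at `a` to classes ending at `b`. (Sub) and (Del) make this transport flat: going
through `b` to `c` agrees with going directly to `c` whenever all three distances are below `ε`. A
global flat section selects one class of even walks at each vertex, and this gives simple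
connectedness (`isSimplyConnected_of_section`).

A flat section exists because `S^n` is simply connected for `n ≥ 2`, but only arcs joining vertices
matter. Some point lies off the finitely many great circles containing them, and stereographic
projection from it puts these circles in a ball (`exists_convex_chart`). The transport, pulled back
to the ball through nearby vertices, has a flat section by radial contraction
(`exists_flat_section_of_convex`). Comparing values along short arcs brings the section back to the
vertices (`exists_flat_section`).

This needs `2δ < min ε π`. Otherwise `ε > π`, the graph is complete, and antipodal symmetry excludes
the bad case of three vertices. -/

namespace BorsukHomotopy

/-! ### Homotopy classes of walks -/

section GraphClasses

variable {V : Type*} {G : SimpleGraph V}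

theorem HomotopyStep.symm {u v : V} {p q : G.Walk u v} (h : HomotopyStep G p q) :
    HomotopyStep G q p := by
  cases h with
  | sub p hab hbc hab' hbc' q => exact .sub p hab' hbc' hab hbc q
  | ins p haw q => exact .del p haw haw.symm q
  | del p haw hwa q => exact .ins p haw q

theorem HomotopyStep.concat {u v w : V} {p q : G.Walk u v} (h : HomotopyStep G p q)
    (hvw : G.Adj v w) : HomotopyStep G (p.concat hvw) (q.concat hvw) := by
  cases h with
  | sub p hab hbc hab' hbc' q =>
    simpa only [← SimpleGraph.Walk.append_concat, SimpleGraph.Walk.concat_cons] using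
      HomotopyStep.sub p hab hbc hab' hbc' (q.concat hvw)
  | ins p haw q =>
    simpa only [← SimpleGraph.Walk.append_concat, SimpleGraph.Walk.concat_cons] using
      HomotopyStep.ins p haw (q.concat hvw)
  | del p haw hwa q =>
    simpa only [← SimpleGraph.Walk.append_concat, SimpleGraph.Walk.concat_cons] using
      HomotopyStep.del p haw hwa (q.concat hvw)

variable (G) in
/-- Homotopy classes of walks from `u` to `v`. -/
def WalkClass (u v : V) : Type _ := Quot (HomotopyStep G (u := u) (v := v))

/-- The homotopy class of a walk. -/
def WalkClass.mk {u v : V} (p : G.Walk u v) : WalkClass G u v := Quot.mk _ p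

/-- Extend a homotopy class of walks by an edge. -/
def WalkClass.extend {u v w : V} (h : G.Adj v w) : WalkClass G u v → WalkClass G u w :=
  Quot.map (fun p => p.concat h) fun _ _ hpq => hpq.concat h

theorem WalkClass.extend_mk {u v w : V} (h : G.Adj v w) (p : G.Walk u v) :
    WalkClass.extend h (.mk p) = .mk (p.concat h) := rfl

theorem WalkClass.mk_eq_iff {u v : V} {p q : G.Walk u v} :
    WalkClass.mk p = .mk q ↔ Homotopic G p q := by
  have symm : ∀ {p q : G.Walk u v}, Homotopic G p q → Homotopic G q p := fun h => by
    induction h with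
    | refl => exact .refl
    | tail _ h ih => exact .head h.symm ih
  refine Quot.eq.trans ⟨fun h => ?_, fun h => ?_⟩
  · induction h with
    | rel _ _ h => exact .single h
    | refl => exact .refl
    | symm _ _ _ ih => exact symm ih
    | trans _ _ _ _ _ ih₁ ih₂ => exact ih₁.trans ih₂
  · induction h with
    | refl => exact .refl _
    | tail _ h ih => exact .trans _ _ _ ih (.rel _ _ h)

theorem WalkClass.extend_extend_symm {u v w : V} (h : G.Adj v w) (h' : G.Adj w v)
    (x : WalkClass G u v) : extend h' (extend h x) = x := by
  induction x using Quot.ind with | mk p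
  refine Quot.sound ?_
  have := HomotopyStep.del p h h' .nil
  simpa [SimpleGraph.Walk.concat_eq_append, ← SimpleGraph.Walk.append_assoc] using this

theorem WalkClass.extend_extend_congr {u a b b' c : V} (hab : G.Adj a b) (hbc : G.Adj b c)
    (hab' : G.Adj a b') (hbc' : G.Adj b' c) (x : WalkClass G u a) :
    extend hbc (extend hab x) = extend hbc' (extend hab' x) := by
  induction x using Quot.ind with | mk p
  refine Quot.sound ?_
  have := HomotopyStep.sub p hab hbc hab' hbc' .nil
  simpa [SimpleGraph.Walk.concat_eq_append, ← SimpleGraph.Walk.append_assoc] using this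

theorem WalkClass.extend_injective {u v w : V} (h : G.Adj v w) :
    Function.Injective (extend h : WalkClass G u v → WalkClass G u w) := by
  intro x y hxy
  rw [← extend_extend_symm h h.symm x, hxy, extend_extend_symm]

/-- A graph is simply connected as soon as, for every base vertex, the homotopy classes of even
walks admit a section that is compatible with extension by two edges. -/
theorem isSimplyConnected_of_section [Nonempty V]
    (H : ∀ u : V, ∃ s : ∀ v, WalkClass G u v, s u = .mk .nil ∧
      ∀ a b c (hab : G.Adj a b) (hbc : G.Adj b c),
        WalkClass.extend hbc (WalkClass.extend hab (s a)) = s c) :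
    IsSimplyConnected G := by
  have even : ∀ u v (s : ∀ v, WalkClass G u v), s u = .mk .nil →
      (∀ a b c (hab : G.Adj a b) (hbc : G.Adj b c),
        WalkClass.extend hbc (WalkClass.extend hab (s a)) = s c) →
      ∀ p : G.Walk u v,
        (Even p.length → WalkClass.mk p = s v) ∧
        (¬ Even p.length → ∀ w (h : G.Adj v w), WalkClass.mk (p.concat h) = s w) := by
    intro u v s hu hs p
    induction p using SimpleGraph.Walk.concatRec with
    | Hnil => exact ⟨fun _ => hu.symm, by simp⟩
    | Hconcat p h ih =>
      have ih := ih s hu hs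
      rw [SimpleGraph.Walk.length_concat, Nat.even_add_one, not_not]
      refine ⟨fun hp => ih.2 hp _ h, fun hp w hw => ?_⟩
      rw [← WalkClass.extend_mk, ← WalkClass.extend_mk, ih.1 hp, hs]
  refine ⟨(SimpleGraph.connected_iff _).2 ⟨fun u v => ?_, inferInstance⟩, fun u v p q hpq => ?_⟩
  · obtain ⟨s, -⟩ := H u
    exact (s v).ind (β := fun _ => G.Reachable u v) fun p => ⟨p⟩
  · obtain ⟨s, hu, hs⟩ := H u
    have hp := even u v s hu hs p
    have hq := even u v s hu hs q
    rw [← WalkClass.mk_eq_iff]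
    by_cases h : Even p.length
    · rw [hp.1 h, hq.1 (by rw [Nat.even_iff] at h ⊢; rw [← h]; exact hpq.symm)]
    · have h' : ¬ Even q.length := by
        rw [Nat.even_iff] at h ⊢; rw [← show _ % 2 = _ % 2 from hpq]; exact h
      -- One more edge makes both odd walks even, and extension is injective. An odd walk is
      -- nonempty, so its end has a neighbour.
      have hnil : ¬ p.Nil := fun hn => h (by
        rw [SimpleGraph.Walk.length_eq_zero_iff.2 hn]; exact Even.zero)
      have hadj := (p.adj_penultimate hnil).symm
      exact WalkClass.extend_injective hadj ((hp.2 h _ hadj).trans (hq.2 h' _ hadj).symm)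

/-- A complete graph on at least four or at most two vertices is simply connected. -/
theorem isSimplyConnected_of_complete [Nonempty V] (hG : ∀ a b : V, a ≠ b → G.Adj a b)
    (hV : (∀ a b c : V, ∃ d, d ≠ a ∧ d ≠ b ∧ d ≠ c) ∨
      ∀ a b c : V, a ≠ b → b ≠ c → a = c) :
    IsSimplyConnected G := by
  classical
  refine isSimplyConnected_of_section fun u => ?_
  obtain hV | hV := hV
  · choose w hw using fun v => hV u v v
    refine ⟨fun v => .extend (hG (w v) v (hw v).2.1)
      (.extend (hG u (w v) (hw v).1.symm) (.mk .nil)),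
      WalkClass.extend_extend_symm _ _ _, fun a b c hab hbc => ?_⟩
    -- With `d` outside `u`, `a`, `c`, both middle vertices `w a` and `b` can be replaced by `d`;
    -- the detour `d, a, d` then cancels.
    obtain ⟨d, hdu, hda, hdc⟩ := hV u a c
    dsimp only
    rw [WalkClass.extend_extend_congr hab hbc (hG _ _ hda.symm) (hG _ _ hdc),
      WalkClass.extend_extend_congr _ (hG (w a) a (hw a).2.1) (hG _ _ hdu.symm) (hG _ _ hda),
      WalkClass.extend_extend_symm]
    exact WalkClass.extend_extend_congr _ _ _ _ _
  · have hr : ∀ v, Nonempty (WalkClass G u v) := fun v => by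
      by_cases h : u = v
      · subst h; exact ⟨.mk .nil⟩
      · exact ⟨.mk (hG u v h).toWalk⟩
    refine ⟨Function.update (fun v => (hr v).some) u (.mk .nil), by simp,
      fun a b c hab hbc => ?_⟩
    obtain rfl := hV a b c hab.ne hbc.ne
    exact WalkClass.extend_extend_symm _ _ _

end GraphClasses

/-! ### Flat sections over convex sets -/

/-- A family of types over a bounded convex set with a flat transport between nearby points has
a flat section with any prescribed value. -/
theorem exists_flat_section_of_convex {E : Type*} [NormedAddCommGroup E] [NormedSpace ℝ E]
    {K : Set E} (hK : Convex ℝ K) (hb : Bornology.IsBounded K) (F : K → Type*) {ρ : ℝ}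
    (hρ : 0 < ρ) (M : ∀ {x y : K}, dist x y < ρ → F x → F y)
    (hid : ∀ {x : K} (h : dist x x < ρ) (ξ : F x), M h ξ = ξ)
    (htri : ∀ {x y z : K} (hxy : dist x y < ρ) (hyz : dist y z < ρ) (hxz : dist x z < ρ)
      (ξ : F x), M hyz (M hxy ξ) = M hxz ξ)
    (k₀ : K) (ξ₀ : F k₀) :
    ∃ s : ∀ k, F k, s k₀ = ξ₀ ∧
      ∀ x y (h : dist x y < ρ), dist x y < ρ / 2 → M h (s x) = s y := by
  obtain ⟨D, hDpos, hD⟩ : ∃ D, 0 < D ∧ ∀ x ∈ K, dist (k₀ : E) x ≤ D := by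
    obtain ⟨D, hD⟩ := Metric.isBounded_iff.1 hb
    exact ⟨max D 1, by positivity, fun x hx => (hD k₀.2 hx).trans (le_max_left _ _)⟩
  let pt : Set.Icc (0 : ℝ) 1 → K → K := fun t x =>
    ⟨AffineMap.lineMap (k₀ : E) (x : E) (t : ℝ), hK.lineMap_mem k₀.2 x.2 t.2⟩
  have dist_pt : ∀ t x y, dist (pt t x) (pt t y) ≤ dist x y := fun t x y => by
    have h : dist (pt t x) (pt t y) = ‖(t : ℝ)‖ * dist x y := by
      simp only [pt, Subtype.dist_eq, dist_eq_norm, AffineMap.lineMap_apply_module]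
      rw [← norm_smul]
      congr 1
      module
    rw [h, Real.norm_of_nonneg t.2.1]
    exact mul_le_of_le_one_left dist_nonneg t.2.2
  have dist_pt' : ∀ t t' x, dist (pt t x) (pt t' x) ≤ dist t t' * D := fun t t' x => by
    have h : dist (pt t x) (pt t' x) = dist (t : ℝ) t' * dist (k₀ : E) x :=
      dist_lineMap_lineMap _ _ _ _
    rw [h]
    exact mul_le_mul_of_nonneg_left (hD _ x.2) dist_nonneg
  have pt_k₀ : ∀ t, pt t k₀ = k₀ := fun t => Subtype.ext (AffineMap.lineMap_same_apply _ _)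
  -- `Q t`: the family pulled back along the contraction at time `t` has a normalized flat section.
  -- The base fibre is compared through `M`, since `pt t k₀ = k₀` is not definitional.
  let Q : Set.Icc (0 : ℝ) 1 → Prop := fun t => ∃ s : ∀ x, F (pt t x),
    (∀ x y (h : dist (pt t x) (pt t y) < ρ), dist x y < ρ / 2 → M h (s x) = s y) ∧
    ∀ h : dist (pt t k₀) k₀ < ρ, M h (s k₀) = ξ₀
  have Q_zero : Q 0 := by
    have h₀ : ∀ x, pt 0 x = k₀ := fun x => Subtype.ext (AffineMap.lineMap_apply_zero _ _)
    have hd : ∀ x, dist k₀ (pt 0 x) < ρ := fun x => by rw [h₀, dist_self]; exact hρ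
    refine ⟨fun x => M (hd x) ξ₀, fun x y h _ => htri _ _ _ _, fun h => ?_⟩
    rw [htri _ _ (by rwa [dist_self]), hid]
  have Q_step : ∀ t t', dist t t' * D < ρ / 2 → Q t → Q t' := by
    rintro t t' htt' ⟨s, hs, hs₀⟩
    have hd : ∀ x, dist (pt t x) (pt t' x) < ρ := fun x =>
      ((dist_pt' t t' x).trans_lt htt').trans (half_lt_self hρ)
    refine ⟨fun x => M (hd x) (s x), fun x y h hxy => ?_, fun h => ?_⟩
    · have h₁ : dist (pt t x) (pt t y) < ρ :=
        ((dist_pt t x y).trans_lt hxy).trans (half_lt_self hρ)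
      have h₂ : dist (pt t x) (pt t' y) < ρ :=
        (dist_triangle _ (pt t y) _).trans_lt (by
          linarith [dist_pt t x y, dist_pt' t t' y])
      dsimp only
      rw [htri _ _ h₂, ← hs x y h₁ hxy, htri _ _ h₂]
    · rw [htri _ _ (by rw [pt_k₀, dist_self]; exact hρ), hs₀]
  have Q_one : Q 1 := by
    obtain ⟨m, hm⟩ := exists_nat_gt (D / (ρ / 2))
    have hmpos : (0 : ℝ) < m := lt_trans (by positivity) hm
    have key : ∀ i : ℕ, ∀ hi : i ≤ m, Q ⟨i / m, by positivity, by
        rw [div_le_one hmpos]; exact_mod_cast hi⟩ := by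
      intro i
      induction i with
      | zero =>
        intro hi
        convert Q_zero
        simp
      | succ i ih =>
        intro hi
        refine Q_step _ _ ?_ (ih (Nat.le_of_succ_le hi))
        rw [Subtype.dist_eq, Real.dist_eq, ← sub_div, Nat.cast_succ, sub_add_cancel_left, abs_div,
          abs_neg, abs_one, abs_of_pos hmpos, one_div_mul_eq_div, div_lt_comm₀ hmpos (by positivity)]
        exact hm
    convert key m le_rfl
    exact Subtype.ext (div_self hmpos.ne').symm
  obtain ⟨s, hs, hs₀⟩ := Q_one
  have pt_one : ∀ x, pt 1 x = x := fun x => Subtype.ext (AffineMap.lineMap_apply_one _ _)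
  have hd : ∀ x, dist (pt 1 x) x < ρ := fun x => by rw [pt_one, dist_self]; exact hρ
  refine ⟨fun x => M (hd x) (s x), hs₀ _, fun x y h hxy => ?_⟩
  have h₁ : dist (pt 1 x) (pt 1 y) < ρ := by rwa [pt_one, pt_one]
  have h₂ : dist (pt 1 x) y < ρ := by rwa [pt_one]
  dsimp only
  rw [htri _ _ h₂, ← hs x y h₁ hxy, htri _ _ h₂]

/-! ### Distance and arcs on the sphere -/

theorem sphereDist_self {n : ℕ} (x : Sphere n) : sphereDist x x = 0 :=
  InnerProductGeometry.angle_self (ne_zero_of_mem_unit_sphere x)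

theorem sphereDist_comm {n : ℕ} (x y : Sphere n) : sphereDist x y = sphereDist y x :=
  InnerProductGeometry.angle_comm _ _

theorem sphereDist_triangle {n : ℕ} (x y z : Sphere n) :
    sphereDist x z ≤ sphereDist x y + sphereDist y z :=
  InnerProductGeometry.angle_le_angle_add_angle _ _ _

theorem sphereDist_le_pi {n : ℕ} (x y : Sphere n) : sphereDist x y ≤ Real.pi :=
  InnerProductGeometry.angle_le_pi _ _

theorem sphereDist_neg_right {n : ℕ} (x y : Sphere n) :
    sphereDist x (-y) = Real.pi - sphereDist x y := by
  simp only [sphereDist, Metric.sphere, coe_neg_sphere, InnerProductGeometry.angle_neg_right]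

theorem sphereDist_eq_zero_iff {n : ℕ} {x y : Sphere n} : sphereDist x y = 0 ↔ x = y := by
  refine ⟨fun h => Subtype.ext ?_, fun h => h ▸ sphereDist_self x⟩
  have h' := InnerProductGeometry.inner_eq_mul_norm_of_angle_eq_zero h
  rw [norm_eq_of_mem_sphere, norm_eq_of_mem_sphere, one_mul] at h'
  exact (inner_eq_one_iff_of_norm_eq_one (norm_eq_of_mem_sphere x) (norm_eq_of_mem_sphere y)).1 h'

theorem continuous_sphereDist {n : ℕ} :
    Continuous fun p : Sphere n × Sphere n => sphereDist p.1 p.2 := by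
  rw [continuous_iff_continuousAt]
  intro p
  have h := InnerProductGeometry.continuousAt_angle
    (x := ((p.1 : EuclideanSpace ℝ (Fin (n + 1))), (p.2 : EuclideanSpace ℝ (Fin (n + 1)))))
    (ne_zero_of_mem_unit_sphere p.1) (ne_zero_of_mem_unit_sphere p.2)
  exact ContinuousAt.comp (f := fun p : Sphere n × Sphere n =>
    ((p.1 : EuclideanSpace ℝ (Fin (n + 1))), (p.2 : EuclideanSpace ℝ (Fin (n + 1))))) h
    (by fun_prop)

theorem exists_dist_lt_imp_sphereDist_lt {X : Type*} [PseudoMetricSpace X] [CompactSpace X] {n : ℕ}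
    {g : X → Sphere n} (hg : Continuous g) {η : ℝ} (hη : 0 < η) :
    ∃ ρ > 0, ∀ x y, dist x y < ρ → sphereDist (g x) (g y) < η := by
  have hu : UniformContinuous fun p : X × X => sphereDist (g p.1) (g p.2) :=
    CompactSpace.uniformContinuous_of_continuous
      (continuous_sphereDist.comp (f := fun p : X × X => (g p.1, g p.2)) (by fun_prop))
  obtain ⟨ρ, hρ, H⟩ := Metric.uniformContinuous_iff.1 hu η hη
  refine ⟨ρ, hρ, fun x y hxy => ?_⟩
  have := H (a := (x, y)) (b := (x, x)) (by
    rw [Prod.dist_eq, dist_self, dist_comm, max_eq_right dist_nonneg]; exact hxy)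
  rw [sphereDist_self, Real.dist_eq, sub_zero] at this
  exact (le_abs_self _).trans_lt this

/-- The first half of the geodesic arc between two non-antipodal points. -/
theorem exists_path_to_midpoint {n : ℕ} {a b m : Sphere n} (hab : sphereDist a b < Real.pi)
    (hm : (m : EuclideanSpace ℝ (Fin (n + 1))) =
      NormedSpace.normalize ((a : EuclideanSpace ℝ (Fin (n + 1))) + b)) :
    ∃ γ : unitInterval → Sphere n, Continuous γ ∧ γ 0 = a ∧ γ 1 = m ∧
      ∀ t, sphereDist (γ t) a ≤ sphereDist a b / 2 ∧
        (γ t : EuclideanSpace ℝ (Fin (n + 1))) ∈ Submodule.span ℝ {(a : EuclideanSpace ℝ _), ↑b} := by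
  have ha := norm_eq_of_mem_sphere a
  have hb := norm_eq_of_mem_sphere b
  set z : unitInterval → EuclideanSpace ℝ (Fin (n + 1)) := fun t => a + (t : ℝ) • b with hz
  have hz0 : ∀ t, z t ≠ 0 := fun t h => by
    have h1 : (a : EuclideanSpace ℝ (Fin (n + 1))) = -((t : ℝ) • b) := eq_neg_of_add_eq_zero_left h
    have h2 : (t : ℝ) = 1 := by
      have := congrArg norm h1
      rw [ha, norm_neg, norm_smul, hb, mul_one, Real.norm_of_nonneg t.2.1] at this
      exact this.symm
    have h3 : a = -b := Subtype.ext (by rw [h1, h2, one_smul]; rfl)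
    rw [h3, sphereDist_comm, sphereDist_neg_right, sphereDist_self, sub_zero] at hab
    exact lt_irrefl _ hab
  refine ⟨fun t => ⟨NormedSpace.normalize (z t), ?_⟩, ?_, ?_, ?_, fun t => ⟨?_, ?_⟩⟩
  · rw [mem_sphere_zero_iff_norm, NormedSpace.norm_normalize_eq_one_iff]
    exact hz0 t
  · refine Continuous.subtype_mk ?_ _
    unfold NormedSpace.normalize
    have : Continuous z := by fun_prop
    exact (this.norm.inv₀ fun t => norm_ne_zero_iff.2 (hz0 t)).smul this
  · refine Subtype.ext ?_
    simp [hz, NormedSpace.normalize, ha]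
  · refine Subtype.ext ?_
    simp [hz, hm]
  · have hsum := InnerProductGeometry.angle_eq_angle_add_add_angle_add_of_mem_span
      (x := (a : EuclideanSpace ℝ (Fin (n + 1)))) (z := b) (hz0 t)
      (Submodule.mem_span_pair.2 ⟨1, ⟨t, t.2.1⟩, by simp [hz]; rfl⟩)
    -- As `t ≤ 1`, the vector `a + t b` is at least as close to `a` as to `b`; the two angles add up
    -- to the angle from `a` to `b`, so the first is at most half.
    have hle : InnerProductGeometry.angle (a : EuclideanSpace ℝ (Fin (n + 1))) (z t) ≤
        InnerProductGeometry.angle (z t) b := by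
      unfold InnerProductGeometry.angle
      refine Real.antitone_arccos ?_
      rw [ha, hb, one_mul, mul_one]
      refine div_le_div_of_nonneg_right ?_ (norm_nonneg _)
      have hc : inner ℝ (a : EuclideanSpace ℝ (Fin (n + 1))) b ≤ 1 := by
        simpa [ha, hb] using real_inner_le_norm (a : EuclideanSpace ℝ (Fin (n + 1))) b
      simp only [hz, inner_add_left, inner_add_right, inner_smul_left, inner_smul_right,
        real_inner_self_eq_norm_sq, ha, hb]
      have := mul_nonneg (sub_nonneg.2 t.2.2) (sub_nonneg.2 hc)
      simp only [conj_trivial]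
      nlinarith
    rw [sphereDist_comm]
    change InnerProductGeometry.angle (a : EuclideanSpace ℝ (Fin (n + 1)))
      (NormedSpace.normalize (z t)) ≤
        InnerProductGeometry.angle (a : EuclideanSpace ℝ (Fin (n + 1))) b / 2
    rw [InnerProductGeometry.angle_normalize_right, hsum]
    linarith
  · exact Submodule.smul_mem _ _ (Submodule.mem_span_pair.2 ⟨1, t, by simp [hz]⟩)

theorem exists_common_midpoint_paths {n : ℕ} {a b : Sphere n} (hab : sphereDist a b < Real.pi) :
    ∃ γ γ' : unitInterval → Sphere n, Continuous γ ∧ Continuous γ' ∧ γ 0 = a ∧ γ' 0 = b ∧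
      γ 1 = γ' 1 ∧
      (∀ t, sphereDist (γ t) a ≤ sphereDist a b / 2 ∧
        (γ t : EuclideanSpace ℝ (Fin (n + 1))) ∈
          Submodule.span ℝ {(a : EuclideanSpace ℝ _), ↑b}) ∧
      (∀ t, sphereDist (γ' t) b ≤ sphereDist a b / 2 ∧
        (γ' t : EuclideanSpace ℝ (Fin (n + 1))) ∈
          Submodule.span ℝ {(a : EuclideanSpace ℝ _), ↑b}) := by
  have h0 : (a : EuclideanSpace ℝ (Fin (n + 1))) + b ≠ 0 := fun h => by
    have h3 : a = -b := Subtype.ext (eq_neg_of_add_eq_zero_left h)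
    rw [h3, sphereDist_comm, sphereDist_neg_right, sphereDist_self, sub_zero] at hab
    exact lt_irrefl _ hab
  let m : Sphere n := ⟨_, mem_sphere_zero_iff_norm.2 (NormedSpace.norm_normalize_eq_one_iff.2 h0)⟩
  obtain ⟨γ, hγ, h₀, h₁, h⟩ := exists_path_to_midpoint (m := m) hab rfl
  obtain ⟨γ', hγ', h₀', h₁', h'⟩ := exists_path_to_midpoint (m := m)
    (sphereDist_comm a b ▸ hab) (congrArg NormedSpace.normalize (add_comm _ _))
  refine ⟨γ, γ', hγ, hγ', h₀, h₀', h₁.trans h₁'.symm, h, fun t => ?_⟩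
  rw [sphereDist_comm a b, Set.pair_comm]
  exact h' t

/-! ### A chart containing the great circles -/

/-- A real vector space is not a finite union of proper subspaces, and a span of two vectors is
proper in dimension above two. -/
theorem exists_notMem_span_pair {ι E : Type*} [Finite ι] [AddCommGroup E] [Module ℝ E]
    (hE : 2 < Module.finrank ℝ E) (x y : ι → E) :
    ∃ z : E, ∀ i, z ∉ Submodule.span ℝ {x i, y i} := by
  classical
  by_contra! hcon
  obtain ⟨i, hi⟩ := Subspace.exists_eq_top_of_iUnion_eq_univ
    (p := fun i => Submodule.span ℝ {x i, y i})
    (Set.eq_univ_of_forall fun z => Set.mem_iUnion.2 (hcon z))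
  have h := finrank_span_finset_le_card (R := ℝ) ({x i, y i} : Finset E)
  rw [Finset.coe_pair, Set.finrank, hi, finrank_top] at h
  exact (h.trans Finset.card_le_two).not_gt hE

theorem exists_sphere_notMem_span_pair {n : ℕ} (hn : 2 ≤ n) {V : Set (Sphere n)} (hV : V.Finite)
    (hne : V.Nonempty) :
    ∃ N : Sphere n, ∀ a ∈ V, ∀ b ∈ V, (N : EuclideanSpace ℝ (Fin (n + 1))) ∉
      Submodule.span ℝ {(a : EuclideanSpace ℝ (Fin (n + 1))), ↑b} := by
  have := hV.to_subtype
  obtain ⟨x, hx⟩ := exists_notMem_span_pair (E := EuclideanSpace ℝ (Fin (n + 1)))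
    (by rw [finrank_euclideanSpace_fin]; omega)
    (fun p : V × V => ((p.1 : Sphere n) : EuclideanSpace ℝ (Fin (n + 1))))
    (fun p => ((p.2 : Sphere n) : EuclideanSpace ℝ (Fin (n + 1))))
  obtain ⟨v, hv⟩ := hne
  have hx0 : x ≠ 0 := fun h => hx (⟨v, hv⟩, ⟨v, hv⟩) (by rw [h]; exact Submodule.zero_mem _)
  refine ⟨⟨NormedSpace.normalize x,
    mem_sphere_zero_iff_norm.2 (NormedSpace.norm_normalize_eq_one_iff.2 hx0)⟩,
    fun a ha b hb h => hx (⟨a, ha⟩, ⟨b, hb⟩) ?_⟩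
  exact (Submodule.smul_mem_iff _ (inv_ne_zero (norm_ne_zero_iff.2 hx0))).1 h

/-- The great circles through pairs of points of a finite set lift continuously to a compact convex
set along a continuous map: a stereographic chart centred off all these circles. -/
theorem exists_convex_chart {n : ℕ} (hn : 2 ≤ n) {V : Set (Sphere n)} (hV : V.Finite)
    (hne : V.Nonempty) :
    ∃ N : Sphere n, ∃ K : Set (Submodule.span ℝ {(N : EuclideanSpace ℝ (Fin (n + 1)))})ᗮ,
      Convex ℝ K ∧ IsCompact K ∧ ∃ g : K → Sphere n, Continuous g ∧
      ∃ κ : {x : Sphere n // ∃ a ∈ V, ∃ b ∈ V, (x : EuclideanSpace ℝ (Fin (n + 1))) ∈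
          Submodule.span ℝ {(a : EuclideanSpace ℝ (Fin (n + 1))), ↑b}} → K,
        Continuous κ ∧ ∀ x, g (κ x) = x := by
  obtain ⟨N, hN⟩ := exists_sphere_notMem_span_pair hn hV hne
  have hN1 := norm_eq_of_mem_sphere N
  set C : Set (Sphere n) := {x | ∃ a ∈ V, ∃ b ∈ V, (x : EuclideanSpace ℝ (Fin (n + 1))) ∈
    Submodule.span ℝ {(a : EuclideanSpace ℝ (Fin (n + 1))), ↑b}} with hC
  have hCcl : IsClosed C := by
    have : C = ⋃ a ∈ V, ⋃ b ∈ V, (fun x : Sphere n => (x : EuclideanSpace ℝ (Fin (n + 1)))) ⁻¹'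
        (Submodule.span ℝ {(a : EuclideanSpace ℝ (Fin (n + 1))), ↑b}) := by
      ext x; simp [hC]
    rw [this]
    exact hV.isClosed_biUnion fun a _ => hV.isClosed_biUnion fun b _ =>
      (Submodule.closed_of_finiteDimensional _).preimage continuous_subtype_val
  have hCsrc : C ⊆ (stereographic hN1).source := by
    rintro x ⟨a, ha, b, hb, hx⟩ rfl
    exact hN a ha b hb hx
  have hcont := (stereographic hN1).continuousOn.mono hCsrc
  obtain ⟨R, hR⟩ := (hCcl.isCompact.image_of_continuousOn hcont).isBounded.subset_closedBall 0
  refine ⟨N, Metric.closedBall 0 R, convex_closedBall _ _, isCompact_closedBall _ _,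
    fun k => (stereographic hN1).symm k, ?_,
    fun x => ⟨stereographic hN1 x, hR ⟨x, x.2, rfl⟩⟩, ?_, fun x => ?_⟩
  · have h := (stereographic hN1).continuousOn_symm
    rw [stereographic_target] at h
    exact (continuousOn_univ.1 h).comp continuous_subtype_val
  · exact (continuousOn_iff_continuous_domRestrict.1 hcont).subtype_mk _
  · exact (stereographic hN1).left_inv (hCsrc x.2)

/-! ### Flat sections over the vertices -/

/-- On a finite `δ`-dense subset of the sphere `S^n`, `n ≥ 2`, every flat transport between points
at distance less than `ε` admits a flat section with any prescribed value. -/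
theorem exists_flat_section {n : ℕ} (hn : 2 ≤ n) {V : Set (Sphere n)} (hV : V.Finite) {δ ε : ℝ}
    (hδ : 0 < δ) (hδε : 2 * δ < ε) (hε : ε ≤ Real.pi)
    (dense : ∀ x : Sphere n, ∃ v ∈ V, sphereDist v x < δ)
    (P : V → Type*) (M : ∀ {a b : V}, sphereDist (a : Sphere n) b < ε → P a → P b)
    (hid : ∀ {a : V} (h : sphereDist (a : Sphere n) a < ε) (ξ : P a), M h ξ = ξ)
    (htri : ∀ {a b c : V} (hab : sphereDist (a : Sphere n) b < ε)
      (hbc : sphereDist (b : Sphere n) c < ε) (hac : sphereDist (a : Sphere n) c < ε) (ξ : P a),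
      M hbc (M hab ξ) = M hac ξ)
    (u : V) (ξ : P u) :
    ∃ s : ∀ v, P v, s u = ξ ∧ ∀ (a b : V) (h : sphereDist (a : Sphere n) b < ε), M h (s a) = s b := by
  obtain ⟨N, K, hKconv, hKcpt, g, hg, κ, hκ, hgκ⟩ := exists_convex_chart hn hV ⟨_, u.2⟩
  have : CompactSpace K := isCompact_iff_compactSpace.1 hKcpt
  have dense' : ∀ x : Sphere n, ∃ v : V, sphereDist (v : Sphere n) x < δ := fun x => by
    obtain ⟨v, hv, h⟩ := dense x
    exact ⟨⟨v, hv⟩, h⟩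
  choose f hf using dense'
  -- The slack `ε - 2δ` pays for replacing both points by vertices within `δ`.
  obtain ⟨ρ, hρ, hgρ⟩ := exists_dist_lt_imp_sphereDist_lt hg (sub_pos.2 hδε)
  have close : ∀ {x y : K}, dist x y < ρ → sphereDist (f (g x) : Sphere n) (f (g y)) < ε := by
    intro x y hxy
    have h1 := sphereDist_triangle (f (g x) : Sphere n) (g x) (f (g y))
    have h2 := sphereDist_triangle (g x) (g y) (f (g y))
    have h3 := hf (g y)
    rw [sphereDist_comm] at h3
    linarith [hf (g x), hgρ x y hxy]
  let pt : V → K := fun a => κ ⟨(a : Sphere n), _, a.2, _, a.2, Submodule.subset_span (by simp)⟩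
  have hgpt : ∀ a, g (pt a) = a := fun a => hgκ _
  have hpt : ∀ a : V, sphereDist (f (g (pt a)) : Sphere n) a < ε := fun a => by
    rw [hgpt]; linarith [hf a]
  have hpt' : ∀ a : V, sphereDist (a : Sphere n) (f (g (pt a))) < ε := fun a => by
    rw [sphereDist_comm]; exact hpt a
  obtain ⟨s, hs₀, hs⟩ := exists_flat_section_of_convex hKconv hKcpt.isBounded
    (fun k => P (f (g k))) hρ (fun h => M (close h)) (fun _ => hid _) (fun _ _ _ => htri _ _ _)
    (pt u) (M (hpt' u) ξ)
  -- While the path stays within `ε - δ` of `c`, its nearby vertices stay within `ε`; transport of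
  -- `s` to `c` is then locally constant, hence constant.
  have along : ∀ (c : V) (α : unitInterval → K), Continuous α →
      (∀ t, sphereDist (g (α t)) c < ε - δ) → ∀ (t t' : unitInterval)
      (h : sphereDist (f (g (α t)) : Sphere n) c < ε)
      (h' : sphereDist (f (g (α t')) : Sphere n) c < ε), M h (s (α t)) = M h' (s (α t')) := by
    intro c α hα hc t t' _ _
    have hclose : ∀ t, sphereDist (f (g (α t)) : Sphere n) c < ε := fun t => by
      linarith [sphereDist_triangle (f (g (α t)) : Sphere n) (g (α t)) c, hf (g (α t)), hc t]
    have hloc : IsLocallyConstant fun t => M (hclose t) (s (α t)) := by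
      rw [IsLocallyConstant.iff_eventually_eq]
      intro t
      filter_upwards [hα.continuousAt (Metric.ball_mem_nhds (α t) (half_pos hρ))] with t' ht'
      rw [Set.mem_preimage, Metric.mem_ball, dist_comm] at ht'
      rw [← hs _ _ (ht'.trans (half_lt_self hρ)) ht', htri _ _ (hclose t)]
    exact hloc.apply_eq_of_isPreconnected isPreconnected_univ (Set.mem_univ t) (Set.mem_univ t')
  refine ⟨fun a => M (hpt a) (s (pt a)), ?_, fun a b hab => ?_⟩
  · have hu : sphereDist (u : Sphere n) u < ε := by rw [sphereDist_self]; linarith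
    dsimp only
    rw [hs₀, htri _ _ hu, hid]
  -- Each half-arc stays within `ε/2 < ε - δ` of its own endpoint. At the common midpoint, flatness
  -- passes from `a` to `b`.
  · obtain ⟨γ, γ', hγ, hγ', h0, h0', h1, ha, hb⟩ := exists_common_midpoint_paths (hab.trans_le hε)
    let α : unitInterval → K := fun t => κ ⟨γ t, _, a.2, _, b.2, (ha t).2⟩
    let α' : unitInterval → K := fun t => κ ⟨γ' t, _, a.2, _, b.2, (hb t).2⟩
    have hα0 : α 0 = pt a := congrArg κ (Subtype.ext h0)
    have hα0' : α' 0 = pt b := congrArg κ (Subtype.ext h0')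
    have hα1 : α 1 = α' 1 := congrArg κ (Subtype.ext h1)
    have hca : ∀ t, sphereDist (g (α t)) a < ε - δ := fun t => by
      rw [hgκ]; linarith [(ha t).1]
    have hcb : ∀ t, sphereDist (g (α' t)) b < ε - δ := fun t => by
      rw [hgκ]; linarith [(hb t).1]
    have transfer : ∀ {k k' : K} (c : V), k = k' → ∀ (h : sphereDist (f (g k) : Sphere n) c < ε)
        (h' : sphereDist (f (g k') : Sphere n) c < ε), M h (s k) = M h' (s k') := by
      rintro k _ c rfl _ _; rfl
    have hma : sphereDist (f (g (α 1)) : Sphere n) a < ε := by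
      linarith [sphereDist_triangle (f (g (α 1)) : Sphere n) (g (α 1)) a, hf (g (α 1)), hca 1]
    have hmb' : sphereDist (f (g (α' 1)) : Sphere n) b < ε := by
      linarith [sphereDist_triangle (f (g (α' 1)) : Sphere n) (g (α' 1)) b, hf (g (α' 1)), hcb 1]
    have hmb : sphereDist (f (g (α 1)) : Sphere n) b < ε := by rw [hα1]; exact hmb'
    have h0a : sphereDist (f (g (α 0)) : Sphere n) a < ε := by rw [hα0]; exact hpt a
    have h0b : sphereDist (f (g (α' 0)) : Sphere n) b < ε := by rw [hα0']; exact hpt b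
    have hαc : Continuous α := hκ.comp (hγ.subtype_mk _)
    have hαc' : Continuous α' := hκ.comp (hγ'.subtype_mk _)
    dsimp only
    rw [transfer a hα0.symm (hpt a) h0a, along a α hαc hca 0 1 h0a hma, htri _ _ hmb,
      transfer b hα1 hmb hmb', along b α' hαc' hcb 1 0 hmb' h0b, transfer b hα0' h0b (hpt b)]

/-! ### Application to walk classes -/

/-- The `δ`-approximations in the main range `2δ < ε ≤ π`, described by their adjacency. -/
theorem isSimplyConnected_of_dense {n : ℕ} (hn : 2 ≤ n) {V : Set (Sphere n)} (hV : V.Finite)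
    {δ ε : ℝ} (hδ : 0 < δ) (hδε : 2 * δ < ε) (hε : ε ≤ Real.pi)
    (neg_mem : ∀ v ∈ V, -v ∈ V) (dense : ∀ x : Sphere n, ∃ v ∈ V, sphereDist v x < δ)
    (G : SimpleGraph V)
    (hG : ∀ a b : V, G.Adj a b ↔ sphereDist (a : Sphere n) (-(b : Sphere n)) < ε) :
    IsSimplyConnected G := by
  have : Nonempty V := by
    obtain ⟨v, hv, -⟩ := dense ⟨EuclideanSpace.single 0 1, by simp⟩
    exact ⟨⟨v, hv⟩⟩
  let neg : V → V := fun v => ⟨-v, neg_mem v v.2⟩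
  have adj_neg : ∀ {a b : V}, sphereDist (a : Sphere n) b < ε → G.Adj a (neg b) := fun h => by
    rw [hG]; simpa [neg] using h
  have neg_adj : ∀ {a b : V}, sphereDist (a : Sphere n) b < ε → G.Adj (neg a) b := fun h =>
    (adj_neg (by rwa [sphereDist_comm])).symm
  have close_neg : ∀ {a b : V}, G.Adj a b → sphereDist (a : Sphere n) (neg b) < ε := fun h =>
    (hG _ _).1 h
  have self_close : ∀ a : V, sphereDist (a : Sphere n) a < ε := fun a => by
    rw [sphereDist_self]; linarith
  refine isSimplyConnected_of_section fun u => ?_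
  obtain ⟨s, hs₀, hs⟩ := exists_flat_section hn hV hδ hδε hε dense (WalkClass G u)
    (fun {a _} h => WalkClass.extend (neg_adj h) ∘ WalkClass.extend (adj_neg (self_close a)))
    (fun _ _ => WalkClass.extend_extend_symm _ _ _)
    -- In `a, -a, b, -b, c` replace the first `-a` by `-b`, cancel `-b, b, -b`, and replace the
    -- remaining `-b` by `-a`.
    (fun {a b c} hab hbc hac x => by
      simp only [Function.comp_apply]
      rw [WalkClass.extend_extend_congr (adj_neg (self_close a)) (neg_adj hab) (adj_neg hab)
        (neg_adj (self_close b)), WalkClass.extend_extend_symm]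
      exact WalkClass.extend_extend_congr _ _ _ _ _)
    u (.mk .nil)
  refine ⟨s, hs₀, fun a b c hab hbc => ?_⟩
  have h1 := close_neg hab
  have h2 : sphereDist (neg b : Sphere n) c < ε := by
    rw [sphereDist_comm]; exact close_neg hbc.symm
  -- The edge pair `a, b, c` is compared with transport from `a` to `-b` to `c`, after inserting `b,
  -- -b, b`.
  have h3 : WalkClass.extend (adj_neg (self_close b)) (WalkClass.extend hab (s a)) =
      s (neg b) :=
    (WalkClass.extend_extend_congr _ _ _ _ _).trans (hs _ _ h1)
  rw [← hs _ _ h2, ← WalkClass.extend_extend_symm (adj_neg (self_close b))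
    (neg_adj (self_close b)) (WalkClass.extend hab (s a)), h3]
  exact WalkClass.extend_extend_congr _ _ _ _ _

/-! ### The complete case -/

theorem sphere_ne_neg {n : ℕ} (x : Sphere n) : x ≠ -x := fun h => by
  have h1 := sphereDist_neg_right x x
  rw [← h, sphereDist_self, sub_zero] at h1
  exact Real.pi_pos.ne h1

theorem exists_ne_of_four {α : Type*} {x y z w : α} (hxy : x ≠ y) (hxz : x ≠ z) (hxw : x ≠ w)
    (hyz : y ≠ z) (hyw : y ≠ w) (hzw : z ≠ w) (a b c : α) : ∃ d, d ≠ a ∧ d ≠ b ∧ d ≠ c := by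
  classical
  obtain ⟨d, -, hd⟩ := Finset.exists_mem_notMem_of_card_lt_card
    (s := {a, b, c}) (t := {x, y, z, w})
    (Finset.card_le_three.trans_lt (by simp [*]))
  exact ⟨d, by simpa using hd⟩

/-- A complete graph on a nonempty antipodally closed set of points is simply connected. -/
theorem isSimplyConnected_of_complete_of_neg_mem {n : ℕ} {V : Set (Sphere n)} (hne : V.Nonempty)
    (neg_mem : ∀ v ∈ V, -v ∈ V) (G : SimpleGraph V) (hG : ∀ a b : V, a ≠ b → G.Adj a b) :
    IsSimplyConnected G := by
  have := hne.to_subtype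
  refine isSimplyConnected_of_complete hG ?_
  let neg : V → V := fun v => ⟨-v, neg_mem v v.2⟩
  have neg_ne : ∀ v, neg v ≠ v := fun v h => sphere_ne_neg (v : Sphere n) (congrArg _ h).symm
  have neg_neg' : ∀ v, neg (neg v) = v := fun v => Subtype.ext (neg_neg _)
  by_cases h : ∃ u w : V, w ≠ u ∧ w ≠ neg u
  · left
    obtain ⟨u, w, h1, h2⟩ := h
    intro a b c
    exact exists_ne_of_four h1.symm (neg_ne u).symm
      (fun h => h2 (by rw [h, neg_neg'])) h2 (neg_ne w).symm
      (fun h => h1 (by rw [← neg_neg' w, ← h, neg_neg'])) a b c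
  · right
    push Not at h
    intro a b c hab hbc
    by_contra hac
    exact hac ((h b a hab).trans (h b c hbc.symm).symm)

end BorsukHomotopy

theorem proposition5p4 (n : ℕ) (hn : 2 ≤ n) (δ ε : ℝ) (hδ : 0 < δ) (hδε : δ < ε / 3)
    (G : (BorsukHomotopy.borsukGraph n ε).Subgraph)
    (hG : BorsukHomotopy.IsApproximation δ G) :
    BorsukHomotopy.IsSimplyConnected G.coe := by
  have hadj : ∀ a b : G.verts, G.coe.Adj a b ↔ (a : BorsukHomotopy.Sphere n) ≠ b ∧
      BorsukHomotopy.sphereDist (a : BorsukHomotopy.Sphere n) (-(b : BorsukHomotopy.Sphere n)) < ε :=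
    fun a b => hG.induced.adj
  have lt_pi_iff : ∀ a b : BorsukHomotopy.Sphere n,
      BorsukHomotopy.sphereDist a (-b) < Real.pi ↔ a ≠ b := fun a b => by
    rw [BorsukHomotopy.sphereDist_neg_right, sub_lt_self_iff, ne_eq,
      ← BorsukHomotopy.sphereDist_eq_zero_iff]
    exact (InnerProductGeometry.angle_nonneg _ _).lt_iff_ne'
  by_cases hsmall : 2 * δ < min ε Real.pi
  · refine BorsukHomotopy.isSimplyConnected_of_dense hn hG.finite hδ hsmall (min_le_right _ _)
      hG.neg_mem hG.dense _ fun a b => ?_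
    rw [hadj, lt_min_iff, lt_pi_iff, and_comm]
  -- Since `2δ < ε` always holds, failure means `π ≤ 2δ < ε`.
  · have hπ : Real.pi < ε := by
      rw [lt_min_iff, not_and_or] at hsmall
      rcases hsmall with h | h <;> linarith
    refine BorsukHomotopy.isSimplyConnected_of_complete_of_neg_mem ?_ hG.neg_mem _ fun a b hab =>
      (hadj a b).2 ⟨fun h => hab (Subtype.ext h),
        (BorsukHomotopy.sphereDist_le_pi _ _).trans_lt hπ⟩
    obtain ⟨v, hv, -⟩ := hG.dense ⟨EuclideanSpace.single 0 1, by simp⟩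
    exact ⟨v, hv⟩
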